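/- Let $n\ge 1$ and $1<q<\infty$. Let $d\gamma(x)=(2\pi)^{-n/2}\exp(-\tfrac12|x|^2)\,dx$ be the standard Gaussian measure on $\mathbb{R}^n$, let $B(x,r)$ denote the open ball with centre $x$ and radius $r$, let $m(x)=\min\{1,1/|x|\}$ (with $m(0)=1$), and let $$D=\{(x,t)\in\mathbb{R}^n\times(0,\infty):\ t<m(x)\}.$$ For $\alpha>0$ the Gaussian tent space $T^{1,q}_\alpha(\gamma)$ with aperture $\alpha$ is the completion of the space $C_{\rm c}(D)$ of continuous compactly supported functions $f:D\to\mathbb{C}$ with respect to the norm $$\|f\|_{T^{1,q}_\alpha(\gamma)}=\int_{\mathbb{R}^n}\Big(\iint_D \frac{\mathbf 1_{B(y,\alpha t)}(x)}{\gamma(B(y,t))}\,|f(y,t)|^q\,d\gamma(y)\,\frac{dt}{t}\Big)^{1/q}d\gamma(x).$$ Theorem (Change of aperture). For all $1<\alpha_0<\alpha$ we have $T^{1,q}_\alpha(\gamma)=T^{1,q}_{\alpha_0}(\gamma)$ with equivalent norms. That is, the identity map of $C_{\rm c}(D)$ extends to a linear isomorphism $e$ of $T^{1,q}_\alpha(\gamma)$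 onto $T^{1,q}_{\alpha_0}(\gamma)$, and there are constants $c,C>0$ such that $$c\,\|F\|_{T^{1,q}_\alpha(\gamma)}\le\|e(F)\|_{T^{1,q}_{\alpha_0}(\gamma)}\le C\,\|F\|_{T^{1,q}_\alpha(\gamma)}\qquad\text{for all }F\in T^{1,q}_\alpha(\gamma).$$ -/

import Mathlib

open MeasureTheory CompactlySupported
open scoped ENNReal

namespace GaussTent

/-- The standard Gaussian measure on `ℝⁿ`, `dγ(x) = (2π)^{-n/2} exp(-|x|²/2) dx`. -/
noncomputable def gaussian (n : ℕ) : Measure (EuclideanSpace ℝ (Fin n)) :=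
  volume.withDensity fun x =>
    ENNReal.ofReal ((2 * Real.pi) ^ (-(n : ℝ) / 2) * Real.exp (-(1 / 2) * ‖x‖ ^ 2))

/-- `m(x) = min {1, 1 / |x|}`, with `m(0) = 1`. -/
noncomputable def m {n : ℕ} (x : EuclideanSpace ℝ (Fin n)) : ℝ :=
  if x = 0 then 1 else min 1 (1 / ‖x‖)

/-- `D = {(x, t) ∈ ℝⁿ × (0, ∞) : t < m(x)}`. -/
def D (n : ℕ) : Set (EuclideanSpace ℝ (Fin n) × ℝ) := {p | 0 < p.2 ∧ p.2 < m p.1}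

/-- The measure `dγ(y) dt / t` on `D`. The density `1 / t` only matters for `t > 0`, as `D` lies in
`ℝⁿ × (0, ∞)`. -/
noncomputable def muD (n : ℕ) : Measure (D n) :=
  ((gaussian n).prod ((volume : Measure ℝ).withDensity fun t => ENNReal.ofReal (1 / t))).comap
    Subtype.val

/-- `(J_α f(x))(y, t) = 1_{B(y, α t)}(x) γ(B(y, t))^{-1/q} f(y, t)`. -/
noncomputable def J {n : ℕ} (q α : ℝ) (f : D n → ℂ) (x : EuclideanSpace ℝ (Fin n)) (p : D n) : ℂ :=
  (Metric.ball p.1.1 (α * p.1.2)).indicator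
    (fun _ => (((gaussian n).real (Metric.ball p.1.1 p.1.2) ^ (-1 / q) : ℝ) : ℂ) * f p) x

/-- The norm of `J_α f` in `L¹(ℝⁿ, dγ(x); L^q(D, dγ(y) dt / t))`, with values in `[0, ∞]`. -/
noncomputable def tentENorm {n : ℕ} (q α : ℝ) (f : D n → ℂ) : ℝ≥0∞ :=
  ∫⁻ x, eLpNorm (J q α f x) (ENNReal.ofReal q) (muD n) ∂(gaussian n)

/-! ### Facts which show that `tentENorm` is a finite norm on `C_c(D)` -/

lemma m_eq {n : ℕ} (x : EuclideanSpace ℝ (Fin n)) : m x = (max 1 ‖x‖)⁻¹ := by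
  unfold m
  split_ifs with h
  · simp [h]
  · have hx : 0 < ‖x‖ := norm_pos_iff.2 h
    rcases le_total 1 ‖x‖ with h1 | h1
    · rw [max_eq_right h1, one_div, min_eq_right (inv_le_one_of_one_le₀ h1)]
    · rw [max_eq_left h1, one_div, min_eq_left ((one_le_inv₀ hx).2 h1), inv_one]

lemma continuous_m {n : ℕ} : Continuous (m : EuclideanSpace ℝ (Fin n) → ℝ) := by
  have : (m : EuclideanSpace ℝ (Fin n) → ℝ) = fun x => (max 1 ‖x‖)⁻¹ := funext m_eq
  rw [this]
  exact (continuous_const.max continuous_norm).inv₀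
    fun x => (lt_of_lt_of_le one_pos (le_max_left _ _)).ne'

lemma m_le_one {n : ℕ} (x : EuclideanSpace ℝ (Fin n)) : m x ≤ 1 := by
  rw [m_eq]; exact inv_le_one_of_one_le₀ (le_max_left _ _)

lemma isOpen_D (n : ℕ) : IsOpen (D n) :=
  (isOpen_lt continuous_const continuous_snd).inter
    (isOpen_lt continuous_snd (continuous_m.comp continuous_fst))

instance gaussian_isFinite (n : ℕ) : IsFiniteMeasure (gaussian n) := by
  refine isFiniteMeasure_withDensity_ofReal (Integrable.hasFiniteIntegral ?_)
  refine Integrable.const_mul ?_ _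
  have h := GaussianFourier.integral_rexp_neg_mul_sq_norm (V := EuclideanSpace ℝ (Fin n)) (b := 1 / 2) (by norm_num)
  refine not_not.1 fun hn => ?_
  rw [integral_undef hn] at h
  have : 0 < (Real.pi / (1 / 2)) ^ ((Module.finrank ℝ (EuclideanSpace ℝ (Fin n)) : ℝ) / 2) := by
    positivity
  linarith

instance gaussian_isOpenPos (n : ℕ) : (gaussian n).IsOpenPosMeasure := by
  have h : (volume : Measure (EuclideanSpace ℝ (Fin n))) ≪ gaussian n :=
    withDensity_absolutelyContinuous' (by fun_prop) (Filter.Eventually.of_forall fun x => by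
      have : 0 < (2 * Real.pi) ^ (-(n : ℝ) / 2) * Real.exp (-(1 / 2) * ‖x‖ ^ 2) := by positivity
      simpa using this)
  exact h.isOpenPosMeasure

lemma gaussian_ball_pos {n : ℕ} (p : D n) :
    0 < (gaussian n).real (Metric.ball p.1.1 p.1.2) :=
  ENNReal.toReal_pos (Metric.measure_ball_pos _ _ p.2.1).ne' (measure_ne_top _ _)

instance muD_finiteOnCompacts (n : ℕ) : IsFiniteMeasureOnCompacts (muD n) := by
  refine ⟨fun K hK => ?_⟩
  rcases K.eq_empty_or_nonempty with rfl | hne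
  · simp
  obtain ⟨p₀, -, hp₀⟩ := hK.exists_isMinOn hne
    (f := fun p : D n => p.1.2) (by fun_prop)
  have ht : 0 < p₀.1.2 := p₀.2.1
  rw [muD, (MeasurableEmbedding.subtype_coe (isOpen_D n).measurableSet).comap_apply]
  have hsub : Subtype.val '' K ⊆ Set.univ ×ˢ Set.Icc p₀.1.2 1 := by
    rintro _ ⟨p, hp, rfl⟩
    exact ⟨trivial, hp₀ hp, (p.2.2.trans_le (m_le_one _)).le⟩
  refine (measure_mono hsub).trans_lt ?_
  rw [Measure.prod_prod]
  refine ENNReal.mul_lt_top (measure_lt_top _ _) ?_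
  rw [withDensity_apply _ measurableSet_Icc]
  refine (setLIntegral_mono (g := fun _ => ENNReal.ofReal (1 / p₀.1.2)) measurable_const
    fun t h => ENNReal.ofReal_le_ofReal (one_div_le_one_div_of_le ht h.1)).trans_lt ?_
  rw [setLIntegral_const]
  exact ENNReal.mul_lt_top ENNReal.ofReal_lt_top (by simp)

instance locallyCompact_D (n : ℕ) : LocallyCompactSpace (D n) :=
  (isOpen_D n).locallyCompactSpace

instance muD_isOpenPos (n : ℕ) : (muD n).IsOpenPosMeasure := by
  refine ⟨fun U hU hne h0 => ?_⟩
  obtain ⟨p, hp⟩ := hne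
  have hV : IsOpen (Subtype.val '' U) := (isOpen_D n).isOpenMap_subtype_val U hU
  rw [muD, (MeasurableEmbedding.subtype_coe (isOpen_D n).measurableSet).comap_apply] at h0
  obtain ⟨A, B, hA, hB, hpA, hpB, hAB⟩ := isOpen_prod_iff.1 hV p.1.1 p.1.2 ⟨p, hp, rfl⟩
  have h1 := measure_mono_null hAB h0
  rw [Measure.prod_prod, mul_eq_zero] at h1
  rcases h1 with h1 | h1
  · exact hA.measure_ne_zero _ ⟨_, hpA⟩ h1
  · have hBpos : ∀ t ∈ B, 0 < t := fun t ht => by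
      obtain ⟨p', -, hp'⟩ := hAB (Set.mk_mem_prod hpA ht)
      have := p'.2.1
      rw [hp'] at this
      exact this
    rw [withDensity_apply _ hB.measurableSet, lintegral_eq_zero_iff (by fun_prop)] at h1
    have h2 : ∀ᵐ t ∂(volume.restrict B), t ∉ B := by
      filter_upwards [h1] with t ht htB
      have := one_div_pos.2 (hBpos t htB)
      simp only [Pi.zero_apply, ENNReal.ofReal_eq_zero] at ht
      linarith
    rw [ae_iff] at h2
    simp only [not_not, Set.ofPred_mem_eq, Measure.restrict_apply_self] at h2
    exact hB.measure_ne_zero _ ⟨_, hpB⟩ h2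

lemma measurable_gaussian_ball (n : ℕ) :
    Measurable fun p : D n => (gaussian n).real (Metric.ball p.1.1 p.1.2) := by
  have hs : MeasurableSet {z : D n × EuclideanSpace ℝ (Fin n) | dist z.2 z.1.1.1 < z.1.1.2} :=
    measurableSet_lt (by fun_prop) (by fun_prop)
  exact (measurable_measure_prodMk_left (ν := gaussian n) hs).ennreal_toReal

lemma measurable_J {n : ℕ} (q α : ℝ) {f : D n → ℂ} (hf : Measurable f) :
    Measurable fun z : EuclideanSpace ℝ (Fin n) × D n => J q α f z.1 z.2 := by
  have hs : MeasurableSet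
      {z : EuclideanSpace ℝ (Fin n) × D n | dist z.1 z.2.1.1 < α * z.2.1.2} :=
    measurableSet_lt (by fun_prop) (by fun_prop)
  have hg : Measurable fun z : EuclideanSpace ℝ (Fin n) × D n =>
      (((gaussian n).real (Metric.ball z.2.1.1 z.2.1.2) ^ (-1 / q) : ℝ) : ℂ) * f z.2 :=
    (Complex.measurable_ofReal.comp
      (((measurable_gaussian_ball n).comp measurable_snd).pow_const _)).mul
      (hf.comp measurable_snd)
  exact hg.indicator hs

lemma measurable_J_right {n : ℕ} (q α : ℝ) {f : D n → ℂ} (hf : Measurable f)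
    (x : EuclideanSpace ℝ (Fin n)) : Measurable (J q α f x) :=
  (measurable_J q α hf).of_uncurry_left (f := J q α f)

lemma measurable_inner {n : ℕ} {q : ℝ} (hq : 1 < q) (α : ℝ) {f : D n → ℂ} (hf : Measurable f) :
    Measurable fun x => eLpNorm (J q α f x) (ENNReal.ofReal q) (muD n) := by
  have h0 : ENNReal.ofReal q ≠ 0 := by simpa using one_pos.trans hq
  simp_rw [eLpNorm_eq_lintegral_rpow_enorm_toReal h0 ENNReal.ofReal_ne_top]
  exact (((measurable_J q α hf).enorm.pow_const _).lintegral_prod_right').pow_const _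

lemma J_add {n : ℕ} (q α : ℝ) (f g : D n → ℂ) (x : EuclideanSpace ℝ (Fin n)) :
    J q α (f + g) x = J q α f x + J q α g x := by
  funext p
  by_cases h : x ∈ Metric.ball p.1.1 (α * p.1.2) <;> simp [J, h, mul_add]

lemma J_smul {n : ℕ} (q α : ℝ) (c : ℂ) (f : D n → ℂ) (x : EuclideanSpace ℝ (Fin n)) :
    J q α (c • f) x = c • J q α f x := by
  funext p
  by_cases h : x ∈ Metric.ball p.1.1 (α * p.1.2)
  · simp [J, h]; ring
  · simp [J, h]

lemma tentENorm_add_le {n : ℕ} {q : ℝ} (hq : 1 < q) (α : ℝ) {f g : D n → ℂ}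
    (hf : Measurable f) (hg : Measurable g) :
    tentENorm q α (f + g) ≤ tentENorm q α f + tentENorm q α g := by
  unfold tentENorm
  rw [← lintegral_add_left (measurable_inner hq α hf)]
  refine lintegral_mono fun x => ?_
  rw [J_add]
  exact eLpNorm_add_le
    (measurable_J_right q α hf x).aestronglyMeasurable
    (measurable_J_right q α hg x).aestronglyMeasurable
    (by rw [← ENNReal.ofReal_one]; exact ENNReal.ofReal_le_ofReal hq.le)

lemma tentENorm_smul {n : ℕ} {q : ℝ} (hq : 1 < q) (α : ℝ) (c : ℂ) {f : D n → ℂ}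
    (hf : Measurable f) :
    tentENorm q α (c • f) = ‖c‖ₑ * tentENorm q α f := by
  unfold tentENorm
  rw [← lintegral_const_mul _ (measurable_inner hq α hf)]
  refine lintegral_congr fun x => ?_
  rw [J_smul, eLpNorm_const_smul]

lemma measurable_coe {n : ℕ} (f : C_c(D n, ℂ)) : Measurable (f : D n → ℂ) :=
  f.continuous.measurable

/-- `γ(B(y, t))^{-1/q}` is locally bounded on `D`. -/
lemma exists_bound_ball {n : ℕ} {q : ℝ} (hq : 1 < q) {K : Set (D n)} (hK : IsCompact K) :
    ∃ C : ℝ, ∀ p ∈ K, (gaussian n).real (Metric.ball p.1.1 p.1.2) ^ (-1 / q) ≤ C := by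
  refine hK.induction_on (p := fun S : Set (D n) => ∃ C : ℝ, ∀ p ∈ S,
    (gaussian n).real (Metric.ball p.1.1 p.1.2) ^ (-1 / q) ≤ C) ⟨0, by simp⟩ ?_ ?_ ?_
  · rintro S T hST ⟨C, hC⟩
    exact ⟨C, fun p hp => hC p (hST hp)⟩
  · rintro S T ⟨C, hC⟩ ⟨C', hC'⟩
    refine ⟨max C C', fun p hp => ?_⟩
    rcases hp with hp | hp
    · exact (hC p hp).trans (le_max_left _ _)
    · exact (hC' p hp).trans (le_max_right _ _)
  · intro p₀ _
    have ht : 0 < p₀.1.2 := p₀.2.1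
    refine ⟨{p : D n | dist p₀.1.1 p.1.1 + p₀.1.2 / 2 < p.1.2}, mem_nhdsWithin_of_mem_nhds
      ((isOpen_lt (by fun_prop) (by fun_prop)).mem_nhds (by simpa using by linarith)),
      (gaussian n).real (Metric.ball p₀.1.1 (p₀.1.2 / 2)) ^ (-1 / q), fun p hp => ?_⟩
    refine Real.rpow_le_rpow_of_nonpos
      (ENNReal.toReal_pos (Metric.measure_ball_pos _ _ (by linarith)).ne' (measure_ne_top _ _)) ?_
      (div_nonpos_of_nonpos_of_nonneg (by norm_num) (by linarith))
    refine measureReal_mono (fun z hz => ?_) (measure_ne_top _ _)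
    have h1 : dist z p₀.1.1 < p₀.1.2 / 2 := hz
    have h2 := dist_triangle z p₀.1.1 p.1.1
    have h3 : dist p₀.1.1 p.1.1 + p₀.1.2 / 2 < p.1.2 := hp
    exact Metric.mem_ball.2 (by linarith)

lemma tentENorm_lt_top {n : ℕ} {q : ℝ} (hq : 1 < q) (α : ℝ) (f : C_c(D n, ℂ)) :
    tentENorm q α f < ∞ := by
  have hK : IsCompact (tsupport f) := f.hasCompactSupport
  obtain ⟨C, hC⟩ := exists_bound_ball hq hK
  obtain ⟨M, hM⟩ := f.hasCompactSupport.exists_bound_of_continuous f.continuous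
  have hKm : MeasurableSet (tsupport f) := (isClosed_tsupport f).measurableSet
  have hb : ∀ x p, ‖J q α f x p‖ ≤ ‖(tsupport f).indicator (fun _ => C * M) p‖ := by
    intro x p
    by_cases hp : p ∈ tsupport f
    · have h0 : 0 ≤ (gaussian n).real (Metric.ball p.1.1 p.1.2) ^ (-1 / q) := by positivity
      have hC0 : 0 ≤ C := h0.trans (hC p hp)
      have hM0 : 0 ≤ M := (norm_nonneg _).trans (hM p)
      rw [Set.indicator_of_mem hp, Real.norm_of_nonneg (mul_nonneg hC0 hM0)]
      refine (norm_indicator_le_norm_self _ _).trans ?_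
      rw [norm_mul, Complex.norm_real, Real.norm_of_nonneg h0]
      exact mul_le_mul (hC p hp) (hM p) (norm_nonneg _) hC0
    · simp [J, image_eq_zero_of_notMem_tsupport hp]
  have hfin : eLpNorm ((tsupport f).indicator fun _ => C * M) (ENNReal.ofReal q) (muD n) < ∞ :=
    (memLp_indicator_const _ hKm _ (Or.inr hK.measure_lt_top.ne)).2
  refine (lintegral_mono fun x => eLpNorm_mono (hb x)).trans_lt ?_
  rw [lintegral_const]
  exact ENNReal.mul_lt_top hfin (measure_lt_top _ _)

/-- `tentENorm` is definite on `C_c(D)` for a positive aperture. -/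
lemma eq_zero_of_tentENorm_eq_zero {n : ℕ} {q α : ℝ} (hq : 1 < q) (hα : 0 < α) (f : C_c(D n, ℂ))
    (h : tentENorm q α f = 0) : f = 0 := by
  have hf := measurable_coe f
  have hq0 : ENNReal.ofReal q ≠ 0 := by simpa using one_pos.trans hq
  rw [tentENorm, lintegral_eq_zero_iff (measurable_inner hq α hf)] at h
  refine DFunLike.ext _ _ fun p₀ => not_not.1 fun hp₀ => ?_
  replace hp₀ : f p₀ ≠ 0 := hp₀
  have hr : 0 < α * p₀.1.2 / 2 := half_pos (mul_pos hα p₀.2.1)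
  -- a point `x` near the centre of `p₀` at which the inner norm vanishes
  have hball : ∃ x ∈ Metric.ball p₀.1.1 (α * p₀.1.2 / 2),
      eLpNorm (J q α f x) (ENNReal.ofReal q) (muD n) = 0 := by
    have h' : ∀ᵐ x ∂(gaussian n), eLpNorm (J q α f x) (ENNReal.ofReal q) (muD n) = 0 := h
    obtain ⟨x, hx0, hx⟩ := (Measure.dense_of_ae h').exists_mem_open Metric.isOpen_ball
      ⟨p₀.1.1, Metric.mem_ball_self hr⟩
    exact ⟨x, hx, hx0⟩
  obtain ⟨x, hx, hx0⟩ := hball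
  have hm := measurable_J_right q α hf x
  rw [eLpNorm_eq_zero_iff hm.aestronglyMeasurable hq0] at hx0
  have hU1 : IsOpen {p : D n | dist x p.1.1 < α * p.1.2} :=
    isOpen_lt (by fun_prop) (by fun_prop)
  have hU : IsOpen {p : D n | f p ≠ 0 ∧ dist x p.1.1 < α * p.1.2} :=
    (isOpen_ne.preimage f.continuous).inter hU1
  have hx' : dist x p₀.1.1 < α * p₀.1.2 := by
    have : dist x p₀.1.1 < α * p₀.1.2 / 2 := hx
    linarith
  have h0 : ∀ᵐ p ∂(muD n), J q α f x p = 0 := hx0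
  obtain ⟨p, hp0, hp1, hp2⟩ := (Measure.dense_of_ae h0).exists_mem_open hU ⟨p₀, hp₀, hx'⟩
  have hmem : x ∈ Metric.ball p.1.1 (α * p.1.2) := hp2
  have hpos := Real.rpow_pos_of_pos (gaussian_ball_pos p) (-1 / q)
  simp only [Set.mem_ofPred_eq, J, hmem, Set.indicator_of_mem] at hp0
  exact mul_ne_zero (Complex.ofReal_ne_zero.2 hpos.ne') hp1 hp0

/-! ### The Gaussian tent spaces -/

/-- The vector space `C_c(D)`, to be normed by `‖f‖ = ‖J_α f‖` in
`L¹(ℝⁿ, dγ; L^q(D, dγ dt / t))`. -/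
def CcTent (n : ℕ) (_q _α : ℝ) : Type := C_c(D n, ℂ)

noncomputable instance (n : ℕ) (q α : ℝ) : AddCommGroup (CcTent n q α) :=
  inferInstanceAs (AddCommGroup C_c(D n, ℂ))

noncomputable instance (n : ℕ) (q α : ℝ) : Module ℂ (CcTent n q α) :=
  inferInstanceAs (Module ℂ C_c(D n, ℂ))

/-- `f ∈ C_c(D)`, seen in the space which carries the norm of aperture `α`. -/
def toCcTent {n : ℕ} (q α : ℝ) (f : C_c(D n, ℂ)) : CcTent n q α := f

/-- The underlying function in `C_c(D)`. -/
def CcTent.fn {n : ℕ} {q α : ℝ} (f : CcTent n q α) : C_c(D n, ℂ) := f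

noncomputable instance (n : ℕ) (q α : ℝ) : Norm (CcTent n q α) :=
  ⟨fun f => (tentENorm q α f.fn).toReal⟩

lemma CcTent.norm_def {n : ℕ} {q α : ℝ} (f : CcTent n q α) :
    ‖f‖ = (tentENorm q α f.fn).toReal := rfl

lemma CcTent.norm_add_le {n : ℕ} {q α : ℝ} (hq : 1 < q) (f g : CcTent n q α) :
    ‖f + g‖ ≤ ‖f‖ + ‖g‖ := by
  have hf := tentENorm_lt_top hq α f.fn
  have hg := tentENorm_lt_top hq α g.fn
  rw [CcTent.norm_def, CcTent.norm_def, CcTent.norm_def, ← ENNReal.toReal_add hf.ne hg.ne]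
  exact ENNReal.toReal_mono (ENNReal.add_lt_top.2 ⟨hf, hg⟩).ne
    (tentENorm_add_le hq α (measurable_coe f.fn) (measurable_coe g.fn))

lemma CcTent.norm_smul {n : ℕ} {q α : ℝ} (hq : 1 < q) (c : ℂ) (f : CcTent n q α) :
    ‖c • f‖ = ‖c‖ * ‖f‖ := by
  have h := congrArg ENNReal.toReal (tentENorm_smul hq α c (measurable_coe f.fn))
  rw [ENNReal.toReal_mul, toReal_enorm] at h
  exact h

/-- For every `α > 0` this is a norm, by `eq_zero_of_tentENorm_eq_zero`. (For `α ≤ 0` it vanishes.)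
-/
noncomputable instance (n : ℕ) (q α : ℝ) [hq : Fact (1 < q)] :
    SeminormedAddCommGroup (CcTent n q α) :=
  SeminormedAddCommGroup.ofCore (𝕜 := ℂ)
    { norm_nonneg := fun _ => ENNReal.toReal_nonneg
      norm_smul := fun c f => CcTent.norm_smul hq.out c f
      norm_triangle := fun f g => CcTent.norm_add_le hq.out f g }

noncomputable instance (n : ℕ) (q α : ℝ) [hq : Fact (1 < q)] : NormedSpace ℂ (CcTent n q α) where
  norm_smul_le c f := (CcTent.norm_smul hq.out c f).le

/-- The Gaussian tent space `T_α^{1,q}(γ)`: the completion of `C_c(D)` for the norm of aperture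
`α`. -/
abbrev TentSpace (n : ℕ) (q α : ℝ) [Fact (1 < q)] : Type :=
  UniformSpace.Completion (CcTent n q α)

/-- The canonical embedding of `C_c(D)` in `T_α^{1,q}(γ)`. -/
noncomputable def embed {n : ℕ} (q α : ℝ) [Fact (1 < q)] (f : C_c(D n, ℂ)) : TentSpace n q α :=
  ((toCcTent q α f : CcTent n q α) : UniformSpace.Completion (CcTent n q α))

/-- The norm of `T_α^{1,q}(γ)` extends the one given on `C_c(D)`. -/
lemma norm_embed {n : ℕ} (q α : ℝ) [Fact (1 < q)] (f : C_c(D n, ℂ)) :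
    ‖embed q α f‖ = (tentENorm q α f).toReal :=
  UniformSpace.Completion.norm_coe (toCcTent q α f)

end GaussTent

namespace GaussTent

/-! Balls grow with the aperture, so only the bound of the norm of aperture `α` by that of aperture
`α₀` needs work. Put w(y,t) = γ(B(y,t))⁻¹|f(y,t)|^q, and let A_α w(x) be its integral over the (y,t)
with x ∈ B(y,αt). The norm is then ∫ (A_α w)^(1/q) dγ, a moment of order 1/q < 1.

The Gaussian measure is not doubling, but on balls B(y,κt) with t < m(y) its density is almost
constant, so it doubles there (`exists_gaussian_ball_le`). This suffices for a good-λ argument. Let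
O = {A_{α₀} w > λ} and enlarge it to H = `denseHull α η O`. A Vitali covering gives γ(H) ≲ γ(O)
(`exists_gaussian_denseHull_le`), and for small η one has γ(B(y,αt) \ H) ≲ γ(B(y,α₀t) \ O)
(`exists_gaussian_diff_denseHull_le`). By Tonelli the latter says that the integral of A_α w over Hᶜ
is controlled by that of A_{α₀} w over Oᶜ. With Chebyshev this bounds γ{A_α w > λ}
(`exists_gaussian_area_lt_le`). Integration against λ^(1/q-1) dλ gives the moment bound
(`lintegral_rpow_le_of_meas_le`), and density of C_c(D) carries it to the completions. -/

/-! ### Doubling of the Gaussian measure on admissible balls -/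

/-- The density of the Gaussian measure with respect to Lebesgue measure. -/
noncomputable def gaussianDensity {n : ℕ} (x : EuclideanSpace ℝ (Fin n)) : ℝ :=
  (2 * Real.pi) ^ (-(n : ℝ) / 2) * Real.exp (-(1 / 2) * ‖x‖ ^ 2)

lemma gaussianDensity_pos {n : ℕ} (x : EuclideanSpace ℝ (Fin n)) : 0 < gaussianDensity x := by
  unfold gaussianDensity; positivity

/-- On an admissible ball, the squared norm oscillates by a bounded amount. -/
lemma abs_normSq_sub_le {n : ℕ} {κ t : ℝ} (hκ : 0 < κ) {x y : EuclideanSpace ℝ (Fin n)}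
    (ht : 0 < t) (hty : t < m y) (hx : x ∈ Metric.ball y (κ * t)) :
    |‖x‖ ^ 2 - ‖y‖ ^ 2| ≤ 2 * κ + κ ^ 2 := by
  have hm := m_eq y
  have hmax : 0 < max 1 ‖y‖ := lt_of_lt_of_le one_pos (le_max_left _ _)
  -- Admissibility gives both t ≤ 1 and t|y| ≤ 1, which bound the two terms of κt(2|y| + κt).
  have h1 : t * max 1 ‖y‖ ≤ 1 := by
    rw [hm, lt_inv_comm₀ ht hmax] at hty
    calc t * max 1 ‖y‖ ≤ t * t⁻¹ := by gcongr
      _ = 1 := mul_inv_cancel₀ ht.ne'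
  have h2 : t ≤ 1 := (hty.trans_le (m_le_one _)).le
  have h3 : t * ‖y‖ ≤ 1 := (mul_le_mul_of_nonneg_left (le_max_right _ _) ht.le).trans h1
  have hd : ‖x - y‖ ≤ κ * t := by
    rw [← dist_eq_norm]; exact (Metric.mem_ball.1 hx).le
  have h4 : |‖x‖ - ‖y‖| ≤ κ * t := (abs_norm_sub_norm_le x y).trans hd
  have h5 : ‖x‖ + ‖y‖ ≤ 2 * ‖y‖ + κ * t := by linarith [(abs_le.1 h4).2]
  calc |‖x‖ ^ 2 - ‖y‖ ^ 2| = |‖x‖ - ‖y‖| * (‖x‖ + ‖y‖) := by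
        rw [sq_sub_sq, abs_mul, abs_of_nonneg (by positivity : 0 ≤ ‖x‖ + ‖y‖), mul_comm]
    _ ≤ κ * t * (2 * ‖y‖ + κ * t) := by gcongr
    _ = 2 * κ * (t * ‖y‖) + κ ^ 2 * (t * t) := by ring
    _ ≤ 2 * κ * 1 + κ ^ 2 * (1 * 1) := by gcongr
    _ = 2 * κ + κ ^ 2 := by ring

lemma gaussianDensity_le {n : ℕ} {x y : EuclideanSpace ℝ (Fin n)} {c : ℝ}
    (h : |‖x‖ ^ 2 - ‖y‖ ^ 2| ≤ c) :
    gaussianDensity x ≤ Real.exp c * gaussianDensity y := by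
  unfold gaussianDensity
  rw [mul_left_comm, ← Real.exp_add]
  gcongr
  have := abs_le.1 h
  have := abs_nonneg (‖x‖ ^ 2 - ‖y‖ ^ 2)
  linarith

lemma gaussian_apply {n : ℕ} {s : Set (EuclideanSpace ℝ (Fin n))} (hs : MeasurableSet s) :
    gaussian n s = ∫⁻ x in s, ENNReal.ofReal (gaussianDensity x) :=
  withDensity_apply _ hs

/-- The Gaussian measure is doubling on admissible balls. -/
lemma exists_gaussian_ball_le (n : ℕ) {a b : ℝ} (ha : 0 < a) (hb : 0 < b) :
    ∃ C : ℝ≥0∞, C ≠ ∞ ∧ ∀ (y : EuclideanSpace ℝ (Fin n)) (t : ℝ), 0 < t → t < m y →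
      gaussian n (Metric.ball y (b * t)) ≤ C * gaussian n (Metric.ball y (a * t)) := by
  -- The factors are the oscillation of the density on the larger ball, the ratio of Lebesgue
  -- volumes, and the oscillation on the smaller ball.
  refine ⟨ENNReal.ofReal (Real.exp (2 * b + b ^ 2)) * ENNReal.ofReal ((b / a) ^ n) *
    ENNReal.ofReal (Real.exp (2 * a + a ^ 2)), by finiteness, fun y t ht hty => ?_⟩
  have hvol : volume (Metric.ball y (b * t)) =
      ENNReal.ofReal ((b / a) ^ n) * volume (Metric.ball y (a * t)) := by
    have h := Measure.addHaar_ball_mul_of_pos (volume : Measure (EuclideanSpace ℝ (Fin n))) y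
      (div_pos hb ha) (a * t)
    rw [finrank_euclideanSpace, Fintype.card_fin, Measure.addHaar_ball_center,
      ← Measure.addHaar_ball_center volume y (a * t)] at h
    rw [← h, Measure.addHaar_ball_center]
    congr 2
    field_simp
  have hup : gaussian n (Metric.ball y (b * t)) ≤
      ENNReal.ofReal (Real.exp (2 * b + b ^ 2) * gaussianDensity y) *
        volume (Metric.ball y (b * t)) := by
    rw [gaussian_apply measurableSet_ball, ← setLIntegral_const]
    exact setLIntegral_mono measurable_const fun x hx =>
      ENNReal.ofReal_le_ofReal (gaussianDensity_le (abs_normSq_sub_le hb ht hty hx))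
  have hlow : ENNReal.ofReal (gaussianDensity y) * volume (Metric.ball y (a * t)) ≤
      ENNReal.ofReal (Real.exp (2 * a + a ^ 2)) * gaussian n (Metric.ball y (a * t)) := by
    rw [gaussian_apply measurableSet_ball, ← setLIntegral_const,
      ← lintegral_const_mul' _ _ ENNReal.ofReal_ne_top]
    refine setLIntegral_mono' measurableSet_ball fun x hx => ?_
    rw [← ENNReal.ofReal_mul (by positivity)]
    refine ENNReal.ofReal_le_ofReal (gaussianDensity_le ?_)
    rw [abs_sub_comm]
    exact abs_normSq_sub_le ha ht hty hx
  calc gaussian n (Metric.ball y (b * t))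
      ≤ _ := hup
    _ = ENNReal.ofReal (Real.exp (2 * b + b ^ 2)) * ENNReal.ofReal ((b / a) ^ n) *
        (ENNReal.ofReal (gaussianDensity y) * volume (Metric.ball y (a * t))) := by
      rw [hvol, ENNReal.ofReal_mul (by positivity)]; ring
    _ ≤ _ := by
      rw [mul_assoc (_ * _) _ (gaussian n _)]
      gcongr

/-! ### The enlarged set and its weak type estimate -/

/-- The union of the admissible balls `B(y, α t)` in which `O` has relative Gaussian measure larger
than `η`. -/
def denseHull {n : ℕ} (α : ℝ) (η : ℝ≥0∞) (O : Set (EuclideanSpace ℝ (Fin n))) :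
    Set (EuclideanSpace ℝ (Fin n)) :=
  ⋃ p ∈ {p : EuclideanSpace ℝ (Fin n) × ℝ | p ∈ D n ∧
    η * gaussian n (Metric.ball p.1 (α * p.2)) < gaussian n (O ∩ Metric.ball p.1 (α * p.2))},
    Metric.ball p.1 (α * p.2)

/-- The weak type `(1, 1)` estimate for the maximal operator over admissible balls. -/
lemma exists_gaussian_denseHull_le (n : ℕ) {α : ℝ} (hα : 0 < α) {η : ℝ≥0∞} (hη : η ≠ 0)
    (hη' : η ≠ ∞) :
    ∃ C : ℝ≥0∞, C ≠ ∞ ∧ ∀ O : Set (EuclideanSpace ℝ (Fin n)), MeasurableSet O →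
      gaussian n (denseHull α η O) ≤ C * gaussian n O := by
  obtain ⟨C, hC, hdoub⟩ := exists_gaussian_ball_le n hα (b := 5 * α) (by positivity)
  refine ⟨C * η⁻¹, ENNReal.mul_ne_top hC (ENNReal.inv_ne_top.2 hη), fun O hO => ?_⟩
  set T := {p : EuclideanSpace ℝ (Fin n) × ℝ | p ∈ D n ∧
    η * gaussian n (Metric.ball p.1 (α * p.2)) < gaussian n (O ∩ Metric.ball p.1 (α * p.2))}
  -- Radii are at most `α` because t < m(y) ≤ 1. Vitali needs an enlargement factor above 3; with 4,
  -- the closed balls lie in open balls of factor 5, where doubling applies.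
  obtain ⟨u, huT, hdisj, hcov⟩ := Vitali.exists_disjoint_subfamily_covering_enlargement_closedBall
    T (fun p => p.1) (fun p => α * p.2) α
    (fun p hp => by
      have := hp.1.2.trans_le (m_le_one p.1)
      nlinarith) 4 (by norm_num)
  have hdisj' : u.PairwiseDisjoint fun p => Metric.ball p.1 (α * p.2) :=
    hdisj.mono fun p => Metric.ball_subset_closedBall
  have hcount : u.Countable := hdisj'.countable_of_isOpen (fun _ _ => Metric.isOpen_ball)
    fun p hp => ⟨p.1, Metric.mem_ball_self (mul_pos hα (huT hp).1.1)⟩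
  have hsub : denseHull α η O ⊆ ⋃ p ∈ u, Metric.ball p.1 (5 * α * p.2) := by
    refine Set.iUnion₂_subset fun p hp => ?_
    obtain ⟨b, hb, hpb⟩ := hcov p hp
    refine (Metric.ball_subset_closedBall.trans hpb).trans
      (Set.Subset.trans ?_ (Set.subset_biUnion_of_mem hb))
    refine Metric.closedBall_subset_ball ?_
    have := mul_pos hα (huT hb).1.1
    linarith
  calc gaussian n (denseHull α η O)
      ≤ ∑' p : u, gaussian n (Metric.ball p.1.1 (5 * α * p.1.2)) :=
        (measure_mono hsub).trans (measure_biUnion_le _ hcount _)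
    _ ≤ ∑' p : u, C * η⁻¹ * gaussian n (O ∩ Metric.ball p.1.1 (α * p.1.2)) := by
        refine ENNReal.tsum_le_tsum fun p => ?_
        refine (hdoub _ _ (huT p.2).1.1 (huT p.2).1.2).trans ?_
        rw [mul_assoc]
        gcongr
        rw [mul_comm η⁻¹, ← div_eq_mul_inv, ENNReal.le_div_iff_mul_le (Or.inl hη) (Or.inl hη'),
          mul_comm]
        exact (huT p.2).2.le
    _ = C * η⁻¹ * gaussian n (⋃ p ∈ u, O ∩ Metric.ball p.1 (α * p.2)) := by
        rw [ENNReal.tsum_mul_left, measure_biUnion hcount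
          (hdisj'.mono fun p => Set.inter_subset_right) fun p _ => hO.inter measurableSet_ball]
    _ ≤ C * η⁻¹ * gaussian n O := by
        gcongr
        exact Set.iUnion₂_subset fun p _ => Set.inter_subset_left

/-- If a ball `B(y, α t)` is not contained in `denseHull α η O`, then `Oᶜ` has a substantial part of
the concentric ball of aperture `α₀`. -/
lemma exists_gaussian_diff_denseHull_le (n : ℕ) {α₀ α : ℝ} (hα₀ : 0 < α₀) (hα : α₀ ≤ α) :
    ∃ η C : ℝ≥0∞, η ≠ 0 ∧ η ≠ ∞ ∧ C ≠ ∞ ∧ ∀ O : Set (EuclideanSpace ℝ (Fin n)),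
      MeasurableSet O → ∀ p : D n,
      gaussian n (Metric.ball p.1.1 (α * p.1.2) \ denseHull α η O) ≤
        C * gaussian n (Metric.ball p.1.1 (α₀ * p.1.2) \ O) := by
  obtain ⟨C, hC, hdoub⟩ := exists_gaussian_ball_le n hα₀ (hα₀.trans_le hα)
  -- This η makes the contribution of O at most half of the measure of the large ball, so that it
  -- can be absorbed. `C + 1` replaces `C` to be nonzero.
  refine ⟨(2 * (C + 1))⁻¹, 2 * (C + 1), ENNReal.inv_ne_zero.2 (by finiteness),
    ENNReal.inv_ne_top.2 (by simp), by finiteness, fun O hO p => ?_⟩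
  set η := (2 * (C + 1))⁻¹ with hη
  by_cases hp : η * gaussian n (Metric.ball p.1.1 (α * p.1.2)) <
      gaussian n (O ∩ Metric.ball p.1.1 (α * p.1.2))
  · have : Metric.ball p.1.1 (α * p.1.2) ⊆ denseHull α η O :=
      Set.subset_biUnion_of_mem (u := fun p : EuclideanSpace ℝ (Fin n) × ℝ =>
        Metric.ball p.1 (α * p.2)) ⟨p.2, hp⟩
    simp [Set.sdiff_eq_empty.2 this]
  · rw [not_lt] at hp
    set B := gaussian n (Metric.ball p.1.1 (α * p.1.2))
    set B₀ := gaussian n (Metric.ball p.1.1 (α₀ * p.1.2))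
    set G := gaussian n (Metric.ball p.1.1 (α₀ * p.1.2) \ O)
    have hB : B ≤ (C + 1) * B₀ := (hdoub p.1.1 p.1.2 p.2.1 p.2.2).trans (by gcongr; simp)
    have hB₀ : B₀ ≤ η * B + G := by
      refine (measure_le_inter_add_sdiff _ _ O).trans (add_le_add_left ((measure_mono ?_).trans hp) _)
      rw [Set.inter_comm]
      exact Set.inter_subset_inter_right _
        (Metric.ball_subset_ball (by have := p.2.1; gcongr))
    have hBfin : B ≠ ∞ := measure_ne_top _ _
    have hmul : (C + 1) * η = 2⁻¹ := by
      rw [hη, ENNReal.mul_inv (by simp) (by simp), mul_left_comm,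
        ENNReal.mul_inv_cancel (by simp) (by finiteness), mul_one]
    have h1 : B ≤ 2⁻¹ * B + (C + 1) * G :=
      calc B ≤ (C + 1) * (η * B + G) := hB.trans (by gcongr)
        _ = (C + 1) * η * B + (C + 1) * G := by ring
        _ = _ := by rw [hmul]
    have h2 : B = 2⁻¹ * B + 2⁻¹ * B := by rw [← add_mul, ENNReal.inv_two_add_inv_two, one_mul]
    -- Absorption is legitimate because the Gaussian measure is finite.
    have h3 : 2⁻¹ * B ≤ (C + 1) * G := by
      nth_rw 1 [h2] at h1
      exact (ENNReal.add_le_add_iff_left (by finiteness)).1 h1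
    calc gaussian n (Metric.ball p.1.1 (α * p.1.2) \ denseHull α η O) ≤ B :=
          measure_mono Set.sdiff_subset
      _ = 2 * (2⁻¹ * B) := by rw [← mul_assoc, ENNReal.mul_inv_cancel (by simp) (by simp), one_mul]
      _ ≤ 2 * ((C + 1) * G) := by gcongr
      _ = _ := by rw [mul_assoc]

/-! ### From a good-λ inequality to moments of order below one -/

/-- The integral of z t^(s-2) over t ≥ z converges at infinity because s < 1, and equals z^s / (1 -
s). -/
lemma lintegral_tail_rpow_le {s : ℝ} (hs : s < 1) {z : ℝ≥0∞} (hz : z ≠ ∞) :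
    ∫⁻ t in Set.Ioi (0 : ℝ), {t : ℝ | z ≤ ENNReal.ofReal t}.indicator
      (fun t => z * ENNReal.ofReal (t ^ (s - 2))) t ≤ ENNReal.ofReal (1 / (1 - s)) * z ^ s := by
  rcases eq_or_ne z 0 with rfl | hz0
  · simp
  have ha : 0 < z.toReal := ENNReal.toReal_pos hz0 hz
  have hset : {t : ℝ | z ≤ ENNReal.ofReal t} = Set.Ici z.toReal := by
    ext t
    rcases le_or_gt t 0 with ht | ht
    · simp only [Set.mem_ofPred_eq, ENNReal.ofReal_of_nonpos ht, nonpos_iff_eq_zero, hz0, Set.mem_Ici,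
        false_iff, not_le]
      exact ht.trans_lt ha
    · exact ENNReal.le_ofReal_iff_toReal_le hz ht.le
  have hint := integrableOn_Ioi_rpow_of_lt (a := s - 2) (by linarith) ha
  calc _ ≤ ∫⁻ t, (Set.Ici z.toReal).indicator
        (fun t => z * ENNReal.ofReal (t ^ (s - 2))) t := by
        rw [hset]; exact setLIntegral_le_lintegral _ _
    _ = z * ENNReal.ofReal (∫ t in Set.Ioi z.toReal, t ^ (s - 2)) := by
        rw [lintegral_indicator measurableSet_Ici, setLIntegral_congr Ioi_ae_eq_Ici.symm,
          lintegral_const_mul' _ _ hz, ofReal_integral_eq_lintegral_ofReal hint]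
        filter_upwards [ae_restrict_mem measurableSet_Ioi] with t ht
        exact Real.rpow_nonneg (ha.le.trans (le_of_lt ht)) _
    _ = ENNReal.ofReal (1 / (1 - s)) * z ^ s := by
        rw [integral_Ioi_rpow_of_lt (by linarith) ha]
        nth_rw 1 [← ENNReal.ofReal_toReal hz]
        nth_rw 3 [← ENNReal.ofReal_toReal hz]
        rw [ENNReal.ofReal_rpow_of_pos ha, ← ENNReal.ofReal_mul ha.le,
          ← ENNReal.ofReal_mul (by rw [one_div, inv_nonneg]; linarith)]
        congr 1
        have h1 : z.toReal ^ s = z.toReal * z.toReal ^ (s - 2 + 1) := by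
          nth_rw 2 [← Real.rpow_one z.toReal]
          rw [← Real.rpow_add ha]
          ring_nf
        rw [h1, show s - 2 + 1 = -(1 - s) by ring, neg_div_neg_eq]
        ring

/-- A good-`λ` inequality with a truncated first moment gives a bound of the moments of order
`s < 1`. -/
lemma lintegral_rpow_le_of_meas_le {X : Type*} [MeasurableSpace X] {μ : Measure X} [SFinite μ]
    {u v : X → ℝ≥0∞} (hu : Measurable u) (hv : Measurable v) (hu' : ∀ᵐ x ∂μ, u x < ∞)
    (hv' : ∀ᵐ x ∂μ, v x < ∞) {s : ℝ} (hs : 0 < s) (hs1 : s < 1) {K : ℝ≥0∞} (hK : K ≠ ∞)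
    (h : ∀ t : ℝ, 0 < t → μ {x | ENNReal.ofReal t < u x} ≤ K * (μ {x | ENNReal.ofReal t < v x} +
      (ENNReal.ofReal t)⁻¹ * ∫⁻ x in {x | v x ≤ ENNReal.ofReal t}, v x ∂μ)) :
    ∫⁻ x, u x ^ s ∂μ ≤
      K * (1 + ENNReal.ofReal s * ENNReal.ofReal (1 / (1 - s))) * ∫⁻ x, v x ^ s ∂μ := by
  -- Layer cake formula; finiteness almost everywhere allows passing to real values.
  have layer : ∀ {w : X → ℝ≥0∞}, Measurable w → (∀ᵐ x ∂μ, w x < ∞) → ∫⁻ x, w x ^ s ∂μ =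
      ENNReal.ofReal s * ∫⁻ t in Set.Ioi (0 : ℝ),
        μ {x | ENNReal.ofReal t < w x} * ENNReal.ofReal (t ^ (s - 1)) := by
    intro w hw hw'
    have h1 := lintegral_rpow_eq_lintegral_meas_lt_mul (μ := μ) (f := fun x => (w x).toReal)
      (Filter.Eventually.of_forall fun _ => ENNReal.toReal_nonneg) hw.ennreal_toReal.aemeasurable hs
    have h2 : ∫⁻ x, w x ^ s ∂μ = ∫⁻ x, ENNReal.ofReal ((w x).toReal ^ s) ∂μ := by
      refine lintegral_congr_ae ?_
      filter_upwards [hw'] with x hx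
      rw [← ENNReal.ofReal_rpow_of_nonneg ENNReal.toReal_nonneg hs.le, ENNReal.ofReal_toReal hx.ne]
    rw [h2, h1]
    congr 1
    refine setLIntegral_congr_fun measurableSet_Ioi fun t ht => ?_
    congr 1
    refine measure_congr ?_
    filter_upwards [hw'] with x hx
    exact propext (ENNReal.ofReal_lt_iff_lt_toReal (le_of_lt ht) hx.ne).symm
  have hS : MeasurableSet {z : ℝ × X | v z.2 ≤ ENNReal.ofReal z.1} :=
    measurableSet_le (by fun_prop) (by fun_prop)
  -- After Tonelli, the inner integral in t is that of `lintegral_tail_rpow_le` with z = v(x).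
  have tail : ∫⁻ t in Set.Ioi (0 : ℝ), ((ENNReal.ofReal t)⁻¹ *
      ∫⁻ x in {x | v x ≤ ENNReal.ofReal t}, v x ∂μ) * ENNReal.ofReal (t ^ (s - 1)) ≤
      ENNReal.ofReal (1 / (1 - s)) * ∫⁻ x, v x ^ s ∂μ := by
    set F : ℝ × X → ℝ≥0∞ := {z : ℝ × X | v z.2 ≤ ENNReal.ofReal z.1}.indicator
      fun z => v z.2 * ENNReal.ofReal (z.1 ^ (s - 2))
    have hF : Measurable F := Measurable.indicator (by fun_prop) hS
    calc _ = ∫⁻ t in Set.Ioi (0 : ℝ), ∫⁻ x, F (t, x) ∂μ := by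
          refine setLIntegral_congr_fun measurableSet_Ioi fun t ht => ?_
          have ht' : (0 : ℝ) < t := ht
          have hpow : (ENNReal.ofReal t)⁻¹ * ENNReal.ofReal (t ^ (s - 1)) =
              ENNReal.ofReal (t ^ (s - 2)) := by
            rw [← ENNReal.ofReal_inv_of_pos ht', ← ENNReal.ofReal_mul (by positivity),
              ← Real.rpow_neg_one, ← Real.rpow_add ht']
            ring_nf
          change ((ENNReal.ofReal t)⁻¹ * ∫⁻ x in {x | v x ≤ ENNReal.ofReal t}, v x ∂μ) *
            ENNReal.ofReal (t ^ (s - 1)) = _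
          rw [mul_right_comm, hpow, ← lintegral_const_mul _ hv,
            ← lintegral_indicator (measurableSet_le hv measurable_const)]
          refine lintegral_congr fun x => ?_
          by_cases hx : v x ≤ ENNReal.ofReal t <;> simp [F, hx, mul_comm]
      _ = ∫⁻ x, ∫⁻ t in Set.Ioi (0 : ℝ), F (t, x) ∂volume ∂μ :=
          lintegral_lintegral_swap hF.aemeasurable
      _ ≤ ∫⁻ x, ENNReal.ofReal (1 / (1 - s)) * v x ^ s ∂μ := by
          refine lintegral_mono_ae ?_
          filter_upwards [hv'] with x hx
          exact lintegral_tail_rpow_le hs1 hx.ne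
      _ = _ := lintegral_const_mul _ (hv.pow_const _)
  have hmeas : Measurable fun t : ℝ =>
      μ {x | ENNReal.ofReal t < v x} * ENNReal.ofReal (t ^ (s - 1)) := by
    have : MeasurableSet {z : ℝ × X | ENNReal.ofReal z.1 < v z.2} :=
      measurableSet_lt (by fun_prop) (by fun_prop)
    exact (measurable_measure_prodMk_left (ν := μ) this).mul (by fun_prop)
  calc ∫⁻ x, u x ^ s ∂μ = ENNReal.ofReal s * ∫⁻ t in Set.Ioi (0 : ℝ),
        μ {x | ENNReal.ofReal t < u x} * ENNReal.ofReal (t ^ (s - 1)) := layer hu hu'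
    _ ≤ ENNReal.ofReal s * ∫⁻ t in Set.Ioi (0 : ℝ), K *
        (μ {x | ENNReal.ofReal t < v x} * ENNReal.ofReal (t ^ (s - 1)) +
        ((ENNReal.ofReal t)⁻¹ * ∫⁻ x in {x | v x ≤ ENNReal.ofReal t}, v x ∂μ) *
          ENNReal.ofReal (t ^ (s - 1))) := by
        gcongr ENNReal.ofReal s * ?_
        refine setLIntegral_mono' measurableSet_Ioi fun t ht => ?_
        rw [← add_mul, ← mul_assoc]
        gcongr
        exact h t ht
    _ ≤ ENNReal.ofReal s * (K * ((∫⁻ t in Set.Ioi (0 : ℝ),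
        μ {x | ENNReal.ofReal t < v x} * ENNReal.ofReal (t ^ (s - 1))) +
        ENNReal.ofReal (1 / (1 - s)) * ∫⁻ x, v x ^ s ∂μ)) := by
        gcongr ENNReal.ofReal s * ?_
        rw [lintegral_const_mul' _ _ hK, lintegral_add_left hmeas]
        gcongr
    _ = K * ((∫⁻ x, v x ^ s ∂μ) + ENNReal.ofReal s *
        (ENNReal.ofReal (1 / (1 - s)) * ∫⁻ x, v x ^ s ∂μ)) := by
        rw [layer hv hv']; ring
    _ = _ := by ring

/-! ### The good-λ inequality for the square function -/

/-- The `q`-th power of the conical square function of aperture `α`, with `w` in the place of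
`γ(B(y, t))⁻¹ |f(y, t)|^q`. -/
noncomputable def area {n : ℕ} (α : ℝ) (w : D n → ℝ≥0∞) (x : EuclideanSpace ℝ (Fin n)) : ℝ≥0∞ :=
  ∫⁻ p : D n, (Metric.ball p.1.1 (α * p.1.2)).indicator (fun _ => w p) x ∂(muD n)

lemma measurable_area_integrand {n : ℕ} (α : ℝ) {w : D n → ℝ≥0∞} (hw : Measurable w) :
    Measurable fun z : EuclideanSpace ℝ (Fin n) × D n =>
      (Metric.ball z.2.1.1 (α * z.2.1.2)).indicator (fun _ => w z.2) z.1 := by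
  have hs : MeasurableSet
      {z : EuclideanSpace ℝ (Fin n) × D n | dist z.1 z.2.1.1 < α * z.2.1.2} :=
    measurableSet_lt (by fun_prop) (by fun_prop)
  exact (hw.comp measurable_snd).indicator hs

lemma measurable_area {n : ℕ} (α : ℝ) {w : D n → ℝ≥0∞} (hw : Measurable w) :
    Measurable (area α w) :=
  (measurable_area_integrand α hw).lintegral_prod_right'

/-- Tonelli. Only the balls need to be measurable, so S may be arbitrary. -/
lemma setLIntegral_area {n : ℕ} (α : ℝ) {w : D n → ℝ≥0∞} (hw : Measurable w)
    (S : Set (EuclideanSpace ℝ (Fin n))) :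
    ∫⁻ x in S, area α w x ∂(gaussian n) =
      ∫⁻ p : D n, w p * gaussian n (Metric.ball p.1.1 (α * p.1.2) ∩ S) ∂(muD n) := by
  unfold area
  rw [lintegral_lintegral_swap (measurable_area_integrand α hw).aemeasurable]
  refine lintegral_congr fun p => ?_
  rw [lintegral_indicator_const measurableSet_ball, Measure.restrict_apply measurableSet_ball]

/-- Inside the enlarged set H the weak type estimate suffices; outside it, Chebyshev and the
comparison of γ(B(y,αt) \ H) with γ(B(y,α₀t) \ O) under the integral in (y,t). -/
lemma exists_gaussian_area_lt_le (n : ℕ) {α₀ α : ℝ} (hα₀ : 0 < α₀) (hα : α₀ ≤ α) :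
    ∃ K : ℝ≥0∞, K ≠ ∞ ∧ ∀ w : D n → ℝ≥0∞, Measurable w → ∀ t : ℝ, 0 < t →
      gaussian n {x | ENNReal.ofReal t < area α w x} ≤
        K * (gaussian n {x | ENNReal.ofReal t < area α₀ w x} + (ENNReal.ofReal t)⁻¹ *
          ∫⁻ x in {x | area α₀ w x ≤ ENNReal.ofReal t}, area α₀ w x ∂(gaussian n)) := by
  obtain ⟨η, C, hη, hη', hC, hgood⟩ := exists_gaussian_diff_denseHull_le n hα₀ hα
  obtain ⟨C', hC', hweak⟩ := exists_gaussian_denseHull_le n (hα₀.trans_le hα) hη hη'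
  refine ⟨C' + C, by finiteness, fun w hw t ht => ?_⟩
  set O := {x | ENNReal.ofReal t < area α₀ w x} with hO
  have hOm : MeasurableSet O := measurableSet_lt measurable_const (measurable_area α₀ hw)
  have hOc : {x | area α₀ w x ≤ ENNReal.ofReal t} = Oᶜ := by ext x; simp [hO]
  have ht0 : ENNReal.ofReal t ≠ 0 := by simpa using ht
  set H := denseHull α η O
  have hint : ∫⁻ x in Hᶜ, area α w x ∂(gaussian n) ≤
      C * ∫⁻ x in Oᶜ, area α₀ w x ∂(gaussian n) := by
    rw [setLIntegral_area α hw, setLIntegral_area α₀ hw, ← lintegral_const_mul' _ _ hC]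
    refine lintegral_mono fun p => ?_
    rw [← Set.sdiff_eq, ← Set.sdiff_eq, mul_left_comm]
    gcongr
    exact hgood O hOm p
  have hcheb : gaussian n ({x | ENNReal.ofReal t < area α w x} \ H) ≤
      (ENNReal.ofReal t)⁻¹ * ∫⁻ x in Hᶜ, area α w x ∂(gaussian n) := by
    rw [mul_comm, ← div_eq_mul_inv]
    refine le_trans ?_ (meas_ge_le_lintegral_div (measurable_area α hw).aemeasurable ht0
      ENNReal.ofReal_ne_top)
    rw [Measure.restrict_apply (measurableSet_le measurable_const (measurable_area α hw))]
    exact measure_mono fun x hx => ⟨(show ENNReal.ofReal t < area α w x from hx.1).le, hx.2⟩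
  calc gaussian n {x | ENNReal.ofReal t < area α w x}
      ≤ gaussian n H + gaussian n ({x | ENNReal.ofReal t < area α w x} \ H) :=
        (measure_le_inter_add_sdiff _ _ H).trans (by gcongr; exact Set.inter_subset_right)
    _ ≤ C' * gaussian n O + (ENNReal.ofReal t)⁻¹ *
        (C * ∫⁻ x in Oᶜ, area α₀ w x ∂(gaussian n)) := by
        gcongr
        · exact hweak O hOm
        · exact hcheb.trans (by gcongr)
    _ = C' * gaussian n O + C * ((ENNReal.ofReal t)⁻¹ *
        ∫⁻ x in Oᶜ, area α₀ w x ∂(gaussian n)) := by ring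
    _ ≤ _ := by
        rw [hOc, mul_add]
        gcongr <;> simp

/-! ### Comparison of the norms on C_c(D) -/

/-- `γ(B(y, t))⁻¹ |f(y, t)|^q`, as a power of the enlarged norm of the function in `J`. -/
noncomputable def weight {n : ℕ} (q : ℝ) (f : D n → ℂ) (p : D n) : ℝ≥0∞ :=
  ‖(((gaussian n).real (Metric.ball p.1.1 p.1.2) ^ (-1 / q) : ℝ) : ℂ) * f p‖ₑ ^ q

lemma measurable_weight {n : ℕ} (q : ℝ) {f : D n → ℂ} (hf : Measurable f) :
    Measurable (weight q f) :=
  ((Complex.measurable_ofReal.comp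
    ((measurable_gaussian_ball n).pow_const _)).mul hf).enorm.pow_const _

lemma tentENorm_eq_lintegral_area {n : ℕ} {q : ℝ} (hq : 1 < q) (α : ℝ) (f : D n → ℂ) :
    tentENorm q α f = ∫⁻ x, area α (weight q f) x ^ (1 / q) ∂(gaussian n) := by
  have hq0 : 0 < q := one_pos.trans hq
  have h0 : ENNReal.ofReal q ≠ 0 := by simpa using hq0
  unfold tentENorm area
  refine lintegral_congr fun x => ?_
  rw [eLpNorm_eq_lintegral_rpow_enorm_toReal h0 ENNReal.ofReal_ne_top, ENNReal.toReal_ofReal hq0.le]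
  congr 1
  refine lintegral_congr fun p => ?_
  by_cases hx : x ∈ Metric.ball p.1.1 (α * p.1.2)
  · simp only [J, Set.indicator_of_mem hx, weight]
  · simp only [J, Set.indicator_of_notMem hx, enorm_zero, ENNReal.zero_rpow_of_pos hq0]

lemma tentENorm_mono {n : ℕ} (q : ℝ) {α₀ α : ℝ} (hα : α₀ ≤ α) (f : D n → ℂ) :
    tentENorm q α₀ f ≤ tentENorm q α f := by
  refine lintegral_mono fun x => eLpNorm_mono fun p => ?_
  exact norm_indicator_le_of_subset
    (Metric.ball_subset_ball (by have := p.2.1; gcongr)) _ _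

/-- Change of aperture for the norms on `C_c(D)`. -/
lemma exists_tentENorm_le (n : ℕ) {q : ℝ} (hq : 1 < q) {α₀ α : ℝ} (hα₀ : 0 < α₀) (hα : α₀ ≤ α) :
    ∃ C : ℝ≥0∞, C ≠ ∞ ∧ ∀ f : C_c(D n, ℂ), tentENorm q α f ≤ C * tentENorm q α₀ f := by
  obtain ⟨K, hK, h⟩ := exists_gaussian_area_lt_le n hα₀ hα
  have hq0 : 0 < q := one_pos.trans hq
  refine ⟨K * (1 + ENNReal.ofReal (1 / q) * ENNReal.ofReal (1 / (1 - 1 / q))), by finiteness,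
    fun f => ?_⟩
  have hw := measurable_weight q (measurable_coe f)
  -- Finiteness of the norm at every aperture, known on C_c(D), makes the square functions finite
  -- almost everywhere.
  have hfin : ∀ β : ℝ, ∀ᵐ x ∂(gaussian n), area β (weight q f) x < ∞ := fun β => by
    have hlt := tentENorm_lt_top hq β f
    rw [tentENorm_eq_lintegral_area hq] at hlt
    filter_upwards [ae_lt_top ((measurable_area β hw).pow_const _) hlt.ne] with x hx
    exact (ENNReal.rpow_lt_top_iff_of_pos (by positivity)).1 hx
  rw [tentENorm_eq_lintegral_area hq, tentENorm_eq_lintegral_area hq]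
  -- The exponent is s = 1/q, and s < 1 is the hypothesis q > 1.
  exact lintegral_rpow_le_of_meas_le (measurable_area α hw) (measurable_area α₀ hw) (hfin α)
    (hfin α₀) (by positivity) ((div_lt_one hq0).2 hq) hK (h _ hw)

/-! ### Passage to the completions -/

/-- The identity map of `C_c(D)`, between the norms of two apertures. -/
noncomputable def idCcTent (n : ℕ) (q α α₀ : ℝ) : CcTent n q α ≃ₗ[ℂ] CcTent n q α₀ :=
  LinearEquiv.refl ℂ C_c(D n, ℂ)

end GaussTent

open GaussTent in
theorem mainTheorem4 (n : ℕ) (hn : 1 ≤ n) (q : ℝ) [Fact (1 < q)] (α₀ α : ℝ)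
    (hα₀ : 1 < α₀) (hα : α₀ < α) :
    ∃ e : GaussTent.TentSpace n q α ≃L[ℂ] GaussTent.TentSpace n q α₀,
      (∀ f : CompactlySupportedContinuousMap (GaussTent.D n) ℂ,
        e (GaussTent.embed q α f) = GaussTent.embed q α₀ f) ∧
      ∃ c C : ℝ, 0 < c ∧ 0 < C ∧
        ∀ F : GaussTent.TentSpace n q α, c * ‖F‖ ≤ ‖e F‖ ∧ ‖e F‖ ≤ C * ‖F‖ := by
  have hq : 1 < q := Fact.out
  obtain ⟨K, hK, hle⟩ := exists_tentENorm_le n hq (one_pos.trans hα₀) hα.le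
  have h₁ : ∀ f : CcTent n q α, ‖(UniformSpace.Completion.toComplₗᵢ (𝕜 := ℂ)).toLinearMap
      (idCcTent n q α α₀ f)‖ ≤ 1 * ‖(UniformSpace.Completion.toComplₗᵢ (𝕜 := ℂ)).toLinearMap f‖ := by
    intro f
    rw [one_mul]
    change ‖embed q α₀ f.fn‖ ≤ ‖embed q α f.fn‖
    rw [norm_embed, norm_embed]
    exact ENNReal.toReal_mono (tentENorm_lt_top hq α f.fn).ne (tentENorm_mono q hα.le f.fn)
  have h₂ : ∀ f : CcTent n q α₀, ‖(UniformSpace.Completion.toComplₗᵢ (𝕜 := ℂ)).toLinearMap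
      ((idCcTent n q α α₀).symm f)‖ ≤
      K.toReal * ‖(UniformSpace.Completion.toComplₗᵢ (𝕜 := ℂ)).toLinearMap f‖ := by
    intro f
    change ‖embed q α f.fn‖ ≤ K.toReal * ‖embed q α₀ f.fn‖
    rw [norm_embed, norm_embed, ← ENNReal.toReal_mul]
    exact ENNReal.toReal_mono (ENNReal.mul_ne_top hK (tentENorm_lt_top hq α₀ f.fn).ne) (hle f.fn)
  have hd : ∀ β : ℝ, DenseRange (UniformSpace.Completion.toComplₗᵢ (𝕜 := ℂ)
      (E := CcTent n q β)).toLinearMap := fun β => UniformSpace.Completion.denseRange_coe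
  -- The identity is bounded both ways between dense subspaces, hence extends to an isomorphism.
  let e := (idCcTent n q α α₀).extend _ _ (hd α) ⟨1, h₁⟩ (hd α₀) ⟨_, h₂⟩
  refine ⟨e, fun f => LinearEquiv.extend_eq _ _ _ (hd α) ⟨1, h₁⟩ (hd α₀) ⟨_, h₂⟩ (toCcTent q α f),
    -- `K.toReal + 1` is certainly positive, whereas `K` could vanish.
    (K.toReal + 1)⁻¹, 1, by positivity, one_pos, fun F => ⟨?_, ?_⟩⟩
  · rw [inv_mul_le_iff₀ (by positivity)]
    have h := LinearEquiv.norm_extend_symm_le _ _ _ K.toReal (hd α) ⟨1, h₁⟩ (hd α₀) h₂ (e F)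
    rw [ContinuousLinearEquiv.symm_apply_apply] at h
    exact h.trans (by gcongr; linarith)
  · exact LinearEquiv.norm_extend_le _ _ _ 1 (hd α) h₁ (hd α₀) ⟨_, h₂⟩ F
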